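/- **Strong representation theorem.** Work in classical first-order logic with equality. The language of arithmetic has the function symbols $0, S, +, \times$; write $\underline{k}$ for the numeral $S^k(0)$, $x \le y$ for $\exists z\,(z + x = y)$ and $x < y$ for $S(x) \le y$. Robinson's arithmetic $Q$ has the axioms $\neg\, S(x) = 0$; $S(x) = S(y) \Rightarrow x = y$; $x = 0 \vee \exists y\,(x = S(y))$; $x + 0 = x$; $x + S(y) = S(x+y)$; $x \times 0 = 0$; $x \times S(y) = x \times y + x$ (universally closed). Programs are the expressions built from the projections $\pi^n_i$, the null functions $Z^n$, $\mathit{Succ}$, $+$, $\times$ and the characteristic function $\chi_{\le}$ (with value $1$ if $x_1 \le x_2$ and $0$ otherwise), by composition $\circ^n_m(h, g_1, \dots, g_m)$ and minimization $\mu^n(g)$. A program of arity $n$ computes a partial function $\mathbb{N}^n \to \mathbb{N}$: a composition is defined at $p_1,\dots,p_n$ when all the $g_i$ are, and $h$ is defined at their values; $\mu^n(g)$ takes the value $r$ at $p_1, \dots, p_n$ when $g(p_1,\dots,p_n,r) = 0$ and $g(p_1,\dots,p_n,z)$ is defined and nonzero for all $z < r$. To each program $f$ of arity $n$ one associates a formula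 $A[x_1,\dots,x_n,y]$ of arithmetic: - $\pi^n_i$: $y = x_i$; $\quad Z^n$: $y = 0$; $\quad \mathit{Succ}$: $y = S(x_1)$; $\quad +$: $y = x_1 + x_2$; $\quad \times$: $y = x_1 \times x_2$; - $\chi_{\le}$: $(x_1 \le x_2 \wedge y = \underline{1}) \vee (x_2 < x_1 \wedge y = 0)$; - $\circ^n_m(h,g_1,\dots,g_m)$: $\exists w_1 \dots \exists w_m\,(B_1[x_1,\dots,x_n,w_1] \wedge \dots \wedge B_m[x_1,\dots,x_n,w_m] \wedge C[w_1,\dots,w_m,y])$, where $B_1,\dots,B_m,C$ are the formulas associated with $g_1,\dots,g_m,h$; - $\mu^n(g)$: $\forall z\,(z < y \Rightarrow \exists w\, B[x_1,\dots,x_n,z,S(w)]) \wedge B[x_1,\dots,x_n,y,0]$, where $B$ is the formula associated with $g$. Let $T$ be any theory extending Robinson's arithmetic, that is, a theory in a language containing that of arithmetic, that proves all the axioms of $Q$. Neither consistency of $T$ nor decidability of its axioms is assumed. Let $f$ be a program of arity $n$, let $A$ be the formula associated with $f$, and let $p_1,\dots,p_n \in \mathbb{N}$. If $f$ terminates at $p_1,\dots,p_n$,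 then $$T \vdash \forall y\,\bigl(A[\underline{p_1},\dots,\underline{p_n},y] \Leftrightarrow y = \underline{f(p_1,\dots,p_n)}\bigr).$$ -/

import Mathlib

open FirstOrder FirstOrder.Language

universe u v

namespace Arith

/-! ### First-order terms, formulas and substitution -/

/-- Terms whose variables are `x₀, …, xₙ₋₁`. -/
abbrev Tm (L : FirstOrder.Language.{u, v}) (n : ℕ) : Type u := L.Term (Empty ⊕ Fin n)

/-- Formulas whose free variables are among `x₀, …, xₙ₋₁`.  In `∀' φ : Fml L n`, the bound variable
is the last variable `xₙ` of `φ : Fml L (n + 1)`. -/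
abbrev Fml (L : FirstOrder.Language.{u, v}) (n : ℕ) : Type (max u v) := L.BoundedFormula Empty n

/-- The variable `xᵢ` as a term. -/
abbrev vr {L : FirstOrder.Language.{u, v}} {n : ℕ} (i : Fin n) : Tm L n := Term.var (Sum.inr i)

/-- Append an entry at the end of a tuple. -/
abbrev snoc {X : Type*} {n : ℕ} (s : Fin n → X) (x : X) : Fin (n + 1) → X :=
  Fin.snoc (α := fun _ => X) s x

/-- Simultaneous substitution of the term `s i` for the variable `xᵢ` in a term. -/
def Tm.sub {L : FirstOrder.Language.{u, v}} {n m : ℕ} (t : Tm L n) (s : Fin n → Tm L m) : Tm L m :=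
  t.subst (Sum.elim Empty.elim s)

/-- A term seen as a term in which one more variable is allowed. -/
def Tm.up {L : FirstOrder.Language.{u, v}} {n : ℕ} (t : Tm L n) : Tm L (n + 1) :=
  t.sub fun i => vr i.castSucc

/-- Simultaneous capture-avoiding substitution of the term `s i` for the free variable `xᵢ` in a
formula. -/
def Fml.sub {L : FirstOrder.Language.{u, v}} : {n m : ℕ} → Fml L n → (Fin n → Tm L m) → Fml L m
  | _, _, .falsum, _ => .falsum
  | _, _, .equal t₁ t₂, s => .equal (Tm.sub t₁ s) (Tm.sub t₂ s)
  | _, _, .rel R ts, s => .rel R fun i => Tm.sub (ts i) s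
  | _, _, .imp φ ψ, s => .imp (Fml.sub φ s) (Fml.sub ψ s)
  | _, m, .all φ, s => .all (Fml.sub φ (snoc (fun i => (s i).up) (vr (Fin.last m))))

/-- A formula seen as a formula in which one more free variable is allowed. -/
def Fml.up {L : FirstOrder.Language.{u, v}} {n : ℕ} (φ : Fml L n) : Fml L (n + 1) :=
  Fml.sub φ fun i => vr i.castSucc

/-- Substitution of `t` for the last variable of a formula. -/
def Fml.inst {L : FirstOrder.Language.{u, v}} {n : ℕ} (φ : Fml L (n + 1)) (t : Tm L n) : Fml L n :=
  Fml.sub φ (snoc (fun i => vr i) t)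

/-- `∃ … ∃`, over the last `m` variables. -/
def exN {L : FirstOrder.Language.{u, v}} {n : ℕ} : (m : ℕ) → Fml L (n + m) → Fml L n
  | 0, φ => φ
  | m + 1, φ => exN m (BoundedFormula.ex φ)

/-! ### Provability -/

/-- Classical natural deduction with equality: `Deriv T Γ φ` says that there is a derivation of `φ`
from the axioms `T` and the hypotheses `Γ`, where `φ` and the members of `Γ` are formulas in the
variables `x₀, …, xₙ₋₁`.  The primitive connectives are `⊥`, `⟹`, `∀` and `=`, the others being the
usual classical abbreviations.  The eigenvariable of a `∀`-introduction is the variable `xₙ`, that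
occurs neither in `T` nor in `Γ`.  The calculus is the usual one for every language that contains a
constant, as all extensions of the language of arithmetic do. -/
inductive Deriv {L : FirstOrder.Language.{u, v}} (T : L.Theory) : {n : ℕ} → List (Fml L n) → Fml L n → Prop
  | ax {n : ℕ} {Γ : List (Fml L n)} (φ : L.Sentence) :
      φ ∈ T → Deriv T Γ (Fml.sub φ fun i : Fin 0 => i.elim0)
  | hyp {n : ℕ} {Γ : List (Fml L n)} {φ : Fml L n} : φ ∈ Γ → Deriv T Γ φ
  | impI {n : ℕ} {Γ : List (Fml L n)} {φ ψ : Fml L n} : Deriv T (φ :: Γ) ψ → Deriv T Γ (φ ⟹ ψ)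
  | impE {n : ℕ} {Γ : List (Fml L n)} {φ ψ : Fml L n} :
      Deriv T Γ (φ ⟹ ψ) → Deriv T Γ φ → Deriv T Γ ψ
  | raa {n : ℕ} {Γ : List (Fml L n)} {φ : Fml L n} : Deriv T (∼φ :: Γ) ⊥ → Deriv T Γ φ
  | allI {n : ℕ} {Γ : List (Fml L n)} {φ : Fml L (n + 1)} :
      Deriv T (Γ.map Fml.up) φ → Deriv T Γ (∀' φ)
  | allE {n : ℕ} {Γ : List (Fml L n)} {φ : Fml L (n + 1)} (t : Tm L n) :
      Deriv T Γ (∀' φ) → Deriv T Γ (Fml.inst φ t)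
  | eqI {n : ℕ} {Γ : List (Fml L n)} (t : Tm L n) : Deriv T Γ (t =' t)
  | eqE {n : ℕ} {Γ : List (Fml L n)} (φ : Fml L (n + 1)) {t₁ t₂ : Tm L n} :
      Deriv T Γ (t₁ =' t₂) → Deriv T Γ (Fml.inst φ t₁) → Deriv T Γ (Fml.inst φ t₂)

/-- The theory `T` proves the sentence `φ`. -/
def Proves {L : FirstOrder.Language.{u, v}} (T : L.Theory) (φ : L.Sentence) : Prop :=
  Deriv T [] φ

/-! ### The language of arithmetic and Robinson's axioms -/

/-- The function symbols `0`, `S`, `+`, `×`. -/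
inductive ArithFunc : ℕ → Type
  | zero : ArithFunc 0
  | succ : ArithFunc 1
  | add : ArithFunc 2
  | mul : ArithFunc 2

/-- The language of arithmetic; its only predicate is equality. -/
def arith : FirstOrder.Language.{0, 0} := ⟨ArithFunc, fun _ => Empty⟩

/-- The term `0`. -/
def zr {n : ℕ} : Tm arith n := Term.func (L := arith) ArithFunc.zero ![]

/-- The term `S(t)`. -/
def sc {n : ℕ} (t : Tm arith n) : Tm arith n := Term.func (L := arith) ArithFunc.succ ![t]

/-- The term `t₁ + t₂`. -/
def ad {n : ℕ} (t₁ t₂ : Tm arith n) : Tm arith n :=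
  Term.func (L := arith) ArithFunc.add ![t₁, t₂]

/-- The term `t₁ × t₂`. -/
def ml {n : ℕ} (t₁ t₂ : Tm arith n) : Tm arith n :=
  Term.func (L := arith) ArithFunc.mul ![t₁, t₂]

/-- The numeral `S(…S(0)…)` of `k`. -/
def numeral {n : ℕ} : ℕ → Tm arith n
  | 0 => zr
  | k + 1 => sc (numeral k)

/-- `t₁ ≤ t₂`, that is `∃ z (z + t₁ = t₂)`. -/
def leF {n : ℕ} (t₁ t₂ : Tm arith n) : Fml arith n :=
  ∃' (ad (vr (Fin.last n)) t₁.up =' t₂.up)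

/-- `t₁ < t₂`, that is `S(t₁) ≤ t₂`. -/
def ltF {n : ℕ} (t₁ t₂ : Tm arith n) : Fml arith n := leF (sc t₁) t₂

/-- The axioms of Robinson's arithmetic. -/
inductive QAxiom : arith.Sentence → Prop
  | succ_ne_zero : QAxiom (∀' ∼(sc (vr (0 : Fin 1)) =' zr))
  | succ_inj :
      QAxiom (∀' ∀' (sc (vr (0 : Fin 2)) =' sc (vr (1 : Fin 2)) ⟹ vr (0 : Fin 2) =' vr (1 : Fin 2)))
  | zero_or_succ :
      QAxiom (∀' (vr (0 : Fin 1) =' zr ⊔ ∃' (vr (0 : Fin 2) =' sc (vr (1 : Fin 2)))))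
  | add_zero : QAxiom (∀' (ad (vr (0 : Fin 1)) zr =' vr (0 : Fin 1)))
  | add_succ :
      QAxiom (∀' ∀' (ad (vr (0 : Fin 2)) (sc (vr (1 : Fin 2))) ='
        sc (ad (vr (0 : Fin 2)) (vr (1 : Fin 2)))))
  | mul_zero : QAxiom (∀' (ml (vr (0 : Fin 1)) zr =' zr))
  | mul_succ :
      QAxiom (∀' ∀' (ml (vr (0 : Fin 2)) (sc (vr (1 : Fin 2))) ='
        ad (ml (vr (0 : Fin 2)) (vr (1 : Fin 2))) (vr (0 : Fin 2))))

/-- Robinson's arithmetic `Q`. -/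
def Q : arith.Theory := {φ | QAxiom φ}

/-! ### Programs -/

/-- Programs of arity `n`, built by the eight clauses: projections, null functions, successor,
addition, multiplication, characteristic function of `≤`, composition and minimization. -/
inductive Prog : ℕ → Type
  | proj {n : ℕ} (i : Fin n) : Prog n
  | zero (n : ℕ) : Prog n
  | succ : Prog 1
  | add : Prog 2
  | mul : Prog 2
  | chiLe : Prog 2
  | comp {n m : ℕ} (h : Prog m) (g : Fin m → Prog n) : Prog n
  | mu {n : ℕ} (g : Prog (n + 1)) : Prog n

/-- The partial function computed by a program: `f` terminates at `p` if `(f.eval p).Dom`.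
Composition is strict, and `mu g` at `p` is the least `r` with `g(p, r) = 0`, provided that
`g(p, z)` is defined for all `z < r`. -/
def Prog.eval : {n : ℕ} → Prog n → (Fin n → ℕ) →. ℕ
  | _, .proj i => fun p => Part.some (p i)
  | _, .zero _ => fun _ => Part.some 0
  | _, .succ => fun p => Part.some (p 0 + 1)
  | _, .add => fun p => Part.some (p 0 + p 1)
  | _, .mul => fun p => Part.some (p 0 * p 1)
  | _, .chiLe => fun p => Part.some (if p 0 ≤ p 1 then 1 else 0)
  | _, .comp h g => fun p =>
      (Part.mk (∀ i, ((g i).eval p).Dom) fun hd i => ((g i).eval p).get (hd i)).bind h.eval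
  | _, .mu g => fun p => Nat.rfind fun z => (g.eval (snoc p z)).map fun w => decide (w = 0)

/-- The proposition `A[x₁, …, xₙ, y]` associated with a program of arity `n`.  The variables
`x₁, …, xₙ` are those of index `0, …, n - 1`, and `y` is that of index `n`. -/
def Prog.rep : {n : ℕ} → Prog n → Fml arith (n + 1)
  | n, .proj i => vr (Fin.last n) =' vr i.castSucc
  | n, .zero _ => vr (Fin.last n) =' zr
  | _, .succ => vr (1 : Fin 2) =' sc (vr (0 : Fin 2))
  | _, .add => vr (2 : Fin 3) =' ad (vr (0 : Fin 3)) (vr (1 : Fin 3))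
  | _, .mul => vr (2 : Fin 3) =' ml (vr (0 : Fin 3)) (vr (1 : Fin 3))
  | _, .chiLe =>
      (leF (vr (0 : Fin 3)) (vr (1 : Fin 3)) ⊓ (vr (2 : Fin 3) =' numeral 1)) ⊔
        (ltF (vr (1 : Fin 3)) (vr (0 : Fin 3)) ⊓ (vr (2 : Fin 3) =' zr))
  | n, .comp (m := m) h g =>
      -- the variables of index `n + 1, …, n + m` are `w₁, …, wₘ`
      exN m (List.foldr (fun φ ψ => φ ⊓ ψ)
        (Fml.sub h.rep
          (snoc (fun i => vr (Fin.natAdd (n + 1) i)) (vr (Fin.castAdd m (Fin.last n)))))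
        (List.ofFn fun i : Fin m => Fml.sub (g i).rep
          (snoc (fun j => vr (Fin.castAdd m j.castSucc)) (vr (Fin.natAdd (n + 1) i)))))
  | n, .mu g =>
      -- `z` is the variable of index `n + 1`, and `w` that of index `n + 2`
      (∀' (ltF (vr (Fin.last (n + 1))) (vr (Fin.last n).castSucc) ⟹
        ∃' Fml.sub g.rep
          (snoc (snoc (fun j => vr j.castSucc.castSucc.castSucc)
            (vr (Fin.last (n + 1)).castSucc)) (sc (vr (Fin.last (n + 2))))))) ⊓
      Fml.sub g.rep (snoc (snoc (fun j => vr j.castSucc) (vr (Fin.last n))) zr)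

/-- The sentence `∀ y (A[p₁, …, pₙ, y] ⇔ y = r)`, where `A` is associated with the program `f`, and
`p₁, …, pₙ` and `r` stand for their numerals. -/
def Prog.repSentence {n : ℕ} (f : Prog n) (p : Fin n → ℕ) (r : ℕ) : arith.Sentence :=
  ∀' (Fml.sub f.rep (snoc (fun i => numeral (p i)) (vr (0 : Fin 1))) ⇔
    (vr (0 : Fin 1) =' numeral r))

end Arith

/-! Everything is proved in `Q` by induction on programs; a derivation in `Q` is then carried into
`T` rule by rule, each axiom being replaced by its given proof. `Represents` strengthens the
induction hypothesis: arguments are arbitrary terms provably equal to numerals, in an arbitrary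
context. Composition needs this, since the intermediate values are eigenvariables rather than
numerals. Because a formula may be added to the context, the metatheoretic equivalence amounts to a
provable one. Minimization is the heart. If `r` is the least zero, `y` is compared with the numeral
of `r`: `y < r` makes `y` a numeral at which `g` is nonzero, against `B[x, y, 0]`; `r < y` makes `g`
nonzero at `r`. Having no induction, `Q` proves neither bounded case analysis nor trichotomy
uniformly, but it proves both against a fixed numeral, by induction on that numeral outside the
theory (`cases_of_ad_eq_numeral`, `lt_trichotomy`). -/

namespace Arith

/-! ### Simultaneous substitution -/

section Substitution

variable {L : FirstOrder.Language.{u, v}} {n m k : ℕ}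

@[simp] theorem snoc_castSucc' {X : Type*} (s : Fin n → X) (x : X) (i : Fin n) :
    snoc s x i.castSucc = s i := Fin.snoc_castSucc (α := fun _ => X) x s i

@[simp] theorem snoc_last' {X : Type*} (s : Fin n → X) (x : X) :
    snoc s x (Fin.last n) = x := Fin.snoc_last (α := fun _ => X) x s

theorem comp_snoc {X Y : Type*} (g : X → Y) (s : Fin n → X) (x : X) :
    (fun i => g (snoc s x i)) = snoc (fun i => g (s i)) (g x) := by
  funext i
  refine Fin.lastCases ?_ (fun i => ?_) i <;> simp

@[simp] theorem Tm.sub_vr (i : Fin n) (s : Fin n → Tm L m) : Tm.sub (vr i) s = s i := rfl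

theorem Tm.sub_func {l : ℕ} (f : L.Functions l) (ts : Fin l → Tm L n) (s : Fin n → Tm L m) :
    Tm.sub (Term.func f ts) s = Term.func f fun i => Tm.sub (ts i) s := rfl

theorem Tm.sub_sub (t : Tm L n) (s : Fin n → Tm L m) (s' : Fin m → Tm L k) :
    (t.sub s).sub s' = t.sub fun i => (s i).sub s' := by
  induction t with
  | var x => rcases x with x | x
             · exact x.elim
             · rfl
  | func f ts ih =>
    rw [Tm.sub_func, Tm.sub_func, Tm.sub_func]
    exact congrArg _ (funext ih)

theorem Tm.sub_id (t : Tm L n) : t.sub (fun i => vr i) = t := by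
  induction t with
  | var x => rcases x with x | x
             · exact x.elim
             · rfl
  | func f ts ih =>
    rw [Tm.sub_func]
    exact congrArg _ (funext ih)

@[simp] theorem Tm.up_vr (i : Fin n) : (vr i : Tm L n).up = vr i.castSucc := rfl

@[simp] theorem Tm.up_sub_snoc (t : Tm L n) (s : Fin n → Tm L m) (u : Tm L m) :
    t.up.sub (snoc s u) = t.sub s := by
  simp [Tm.up, Tm.sub_sub]

theorem Tm.sub_up (t : Tm L n) (s : Fin n → Tm L m) :
    (t.sub s).up = t.sub fun i => (s i).up := Tm.sub_sub _ _ _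

theorem Tm.snoc_sub (s : Fin n → Tm L m) (x : Tm L m) (s' : Fin m → Tm L k) :
    (fun i => Tm.sub (snoc s x i) s') = snoc (fun i => (s i).sub s') (x.sub s') :=
  comp_snoc (fun t => Tm.sub t s') s x

theorem Fml.sub_sub (φ : Fml L n) (s : Fin n → Tm L m) (s' : Fin m → Tm L k) :
    (φ.sub s).sub s' = φ.sub fun i => (s i).sub s' := by
  induction φ generalizing m k with
  | falsum => rfl
  | equal t₁ t₂ => simp only [Fml.sub, Tm.sub_sub]
  | rel R ts => simp only [Fml.sub, Tm.sub_sub]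
  | imp φ ψ ih₁ ih₂ => simp only [Fml.sub, ih₁, ih₂]
  | all φ ih =>
    simp only [Fml.sub, ih, Tm.snoc_sub, Tm.up_sub_snoc, Tm.sub_vr,
      snoc_last', Tm.sub_up]

theorem snoc_vr : snoc (fun i : Fin n => (vr i.castSucc : Tm L (n + 1))) (vr (Fin.last n)) =
    fun i => vr i := by
  funext i
  refine Fin.lastCases ?_ (fun i => ?_) i <;> simp

theorem Fml.sub_id (φ : Fml L n) : φ.sub (fun i => vr i) = φ := by
  induction φ with
  | falsum => rfl
  | equal t₁ t₂ => simp only [Fml.sub, Tm.sub_id]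
  | rel R ts => simp only [Fml.sub, Tm.sub_id]
  | imp φ ψ ih₁ ih₂ => simp only [Fml.sub, ih₁, ih₂]
  | all φ ih => simp only [Fml.sub, Tm.up_vr, snoc_vr, ih]

theorem Fml.up_sub_snoc (φ : Fml L n) (s : Fin n → Tm L m) (u : Tm L m) :
    φ.up.sub (snoc s u) = φ.sub s := by
  simp [Fml.up, Fml.sub_sub]

/-- This commutation is what makes the rules `allE` and `eqE` stable under substitution. -/
theorem Fml.inst_sub (φ : Fml L (n + 1)) (t : Tm L n) (s : Fin n → Tm L m) :
    (φ.inst t).sub s =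
      (φ.sub (snoc (fun i => (s i).up) (vr (Fin.last m)))).inst (t.sub s) := by
  simp only [Fml.inst, Fml.sub_sub, Tm.snoc_sub, Tm.up_sub_snoc, Tm.sub_vr,
      snoc_last', Tm.sub_id]

theorem Fml.sub_snoc_eq_inst (φ : Fml L (n + 1)) (s : Fin n → Tm L m) (t : Tm L m) :
    φ.sub (snoc s t) = (φ.sub (snoc (fun i => (s i).up) (vr (Fin.last m)))).inst t := by
  simp only [Fml.inst, Fml.sub_sub, Tm.snoc_sub, Tm.up_sub_snoc, Tm.sub_vr,
      snoc_last', Tm.sub_id]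

theorem Fml.up_sub (φ : Fml L n) (s : Fin n → Tm L m) :
    φ.up.sub (snoc (fun i => (s i).up) (vr (Fin.last m))) = (φ.sub s).up := by
  rw [Fml.up_sub_snoc, Fml.up, Fml.sub_sub]
  rfl

theorem Fml.sub_bdEqual (t₁ t₂ : Tm L n) (s : Fin n → Tm L m) :
    Fml.sub (t₁ =' t₂) s = (Tm.sub t₁ s =' Tm.sub t₂ s) := rfl

theorem Fml.sub_imp (φ ψ : Fml L n) (s : Fin n → Tm L m) :
    Fml.sub (φ ⟹ ψ) s = (Fml.sub φ s ⟹ Fml.sub ψ s) := rfl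

theorem Fml.sub_not (φ : Fml L n) (s : Fin n → Tm L m) :
    Fml.sub (∼φ) s = ∼(Fml.sub φ s) := rfl

theorem Fml.sub_sup (φ ψ : Fml L n) (s : Fin n → Tm L m) :
    Fml.sub (φ ⊔ ψ) s = (Fml.sub φ s ⊔ Fml.sub ψ s) := rfl

theorem Fml.sub_inf (φ ψ : Fml L n) (s : Fin n → Tm L m) :
    Fml.sub (φ ⊓ ψ) s = (Fml.sub φ s ⊓ Fml.sub ψ s) := rfl

theorem Fml.sub_ex (φ : Fml L (n + 1)) (s : Fin n → Tm L m) :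
    Fml.sub (∃' φ) s = ∃' Fml.sub φ (snoc (fun i => (s i).up) (vr (Fin.last m))) := rfl

end Substitution

/-! ### Derived rules of natural deduction -/

namespace Deriv

variable {L : FirstOrder.Language.{u, v}} {T : L.Theory} {n m : ℕ} {Γ Δ : List (Fml L n)}
  {φ ψ χ : Fml L n}

theorem weaken (h : Deriv T Γ φ) (hΓ : Γ ⊆ Δ) : Deriv T Δ φ := by
  induction h with
  | ax φ hφ => exact .ax φ hφ
  | hyp hφ => exact .hyp (hΓ hφ)
  | impI _ ih => exact .impI (ih (List.cons_subset_cons _ hΓ))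
  | impE _ _ ih₁ ih₂ => exact .impE (ih₁ hΓ) (ih₂ hΓ)
  | raa _ ih => exact .raa (ih (List.cons_subset_cons _ hΓ))
  | allI _ ih => exact .allI (ih (List.map_subset _ hΓ))
  | allE t _ ih => exact .allE t (ih hΓ)
  | eqI t => exact .eqI t
  | eqE φ _ _ ih₁ ih₂ => exact .eqE φ (ih₁ hΓ) (ih₂ hΓ)

theorem wk (h : Deriv T Γ φ) : Deriv T (ψ :: Γ) φ := h.weaken (List.subset_cons_self _ _)

/-- Axioms are closed, so they are unaffected; at a `∀`-introduction the eigenvariable `xₙ` is sent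
to the fresh variable `xₘ`. Moving a derivation under a quantifier (`up`) is a special case. -/
theorem sub (h : Deriv T Γ φ) (s : Fin n → Tm L m) :
    Deriv T (Γ.map fun γ => γ.sub s) (φ.sub s) := by
  induction h generalizing m with
  | ax φ hφ =>
    rw [Fml.sub_sub]
    have e : (fun i : Fin 0 => Tm.sub (i.elim0 : Tm L _) s) = fun i : Fin 0 => i.elim0 :=
      funext fun i => i.elim0
    rw [e]
    exact .ax φ hφ
  | hyp hφ => exact .hyp (List.mem_map_of_mem hφ)
  | impI _ ih => exact .impI (ih s)
  | impE _ _ ih₁ ih₂ => exact .impE (ih₁ s) (ih₂ s)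
  | raa _ ih => exact .raa (ih s)
  | allI _ ih =>
    refine .allI ?_
    have := ih (snoc (fun i => (s i).up) (vr (Fin.last m)))
    simpa only [List.map_map, Function.comp_def, Fml.up_sub] using this
  | allE t _ ih => rw [Fml.inst_sub]; exact .allE _ (ih s)
  | eqI t => exact .eqI _
  | eqE φ _ _ ih₁ ih₂ =>
    have := ih₂ s
    rw [Fml.inst_sub] at this ⊢
    exact .eqE _ (ih₁ s) this

theorem up (h : Deriv T Γ φ) : Deriv T (Γ.map Fml.up) φ.up := h.sub _

theorem cut (h : Deriv T Δ φ) (hΔ : ∀ γ ∈ Δ, Deriv T Γ γ) : Deriv T Γ φ := by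
  induction Δ generalizing φ with
  | nil => exact h.weaken (List.nil_subset _)
  | cons γ Δ ih =>
    exact .impE (ih (.impI h) fun δ hδ => hΔ δ (List.mem_cons_of_mem _ hδ))
      (hΔ γ List.mem_cons_self)

theorem hd : Deriv T (φ :: Γ) φ := .hyp List.mem_cons_self

theorem exfalso (h : Deriv T Γ ⊥) : Deriv T Γ φ := .raa h.wk

theorem andI (h₁ : Deriv T Γ φ) (h₂ : Deriv T Γ ψ) : Deriv T Γ (φ ⊓ ψ) :=
  .impI (.impE (.impE hd h₁.wk) h₂.wk)

theorem andE₁ (h : Deriv T Γ (φ ⊓ ψ)) : Deriv T Γ φ :=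
  .raa (.impE h.wk (.impI (.impI (.impE hd.wk.wk hd.wk))))

theorem andE₂ (h : Deriv T Γ (φ ⊓ ψ)) : Deriv T Γ ψ :=
  .raa (.impE h.wk (.impI hd.wk))

theorem orI₁ (h : Deriv T Γ φ) : Deriv T Γ (φ ⊔ ψ) := .impI (.exfalso (.impE hd h.wk))

theorem orI₂ (h : Deriv T Γ ψ) : Deriv T Γ (φ ⊔ ψ) := .impI h.wk

theorem orE (h : Deriv T Γ (φ ⊔ ψ)) (h₁ : Deriv T (φ :: Γ) χ) (h₂ : Deriv T (ψ :: Γ) χ) :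
    Deriv T Γ χ :=
  .raa (.impE hd (.impE h₂.impI.wk
    (.impE h.wk (.impI (.impE hd.wk (.impE h₁.impI.wk.wk hd))))))

theorem iffI (h₁ : Deriv T (φ :: Γ) ψ) (h₂ : Deriv T (ψ :: Γ) φ) : Deriv T Γ (φ ⇔ ψ) :=
  andI (.impI h₁) (.impI h₂)

theorem exI {φ : Fml L (n + 1)} (t : Tm L n) (h : Deriv T Γ (φ.inst t)) : Deriv T Γ (∃' φ) :=
  .impI (.impE (.allE (φ := ∼φ) t hd) h.wk)

/-- Since `∃'` abbreviates `∼∀'∼`, it suffices to refute `φ` for a fresh variable under the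
assumption `∼ψ`. -/
theorem exE {φ : Fml L (n + 1)} (h : Deriv T Γ (∃' φ))
    (h' : Deriv T (φ :: Γ.map Fml.up) ψ.up) : Deriv T Γ ψ :=
  .raa (.impE h.wk (.allI (.impI (.impE (φ := ψ.up) (.hyp (by
    simp only [List.map_cons, List.mem_cons]; exact .inr (.inl rfl)))
    (h'.weaken (List.cons_subset_cons _ (by simp)))))))

theorem symm {a b : Tm L n} (h : Deriv T Γ (a =' b)) : Deriv T Γ (b =' a) := by
  have := eqE (vr (Fin.last n) =' a.up) h
  simp only [Fml.inst, Fml.sub_bdEqual, Tm.up_sub_snoc, Tm.sub_vr, snoc_last', Tm.sub_id] at this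
  exact this (.eqI a)

theorem trans {a b c : Tm L n} (h : Deriv T Γ (a =' b)) (h' : Deriv T Γ (b =' c)) :
    Deriv T Γ (a =' c) := by
  have := eqE (a.up =' vr (Fin.last n)) h'
  simp only [Fml.inst, Fml.sub_bdEqual, Tm.up_sub_snoc, Tm.sub_vr, snoc_last', Tm.sub_id] at this
  exact this h

theorem congr_snoc (u : Tm L (m + 1)) (s : Fin m → Tm L n) {a b : Tm L n}
    (h : Deriv T Γ (a =' b)) : Deriv T Γ (u.sub (snoc s a) =' u.sub (snoc s b)) := by
  -- The left side ignores the replaced variable, so instantiating it at `a` gives a reflexive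
  -- equation.
  have := eqE ((u.sub (snoc s a)).up =' u.sub (snoc (fun i => (s i).up) (vr (Fin.last n)))) h
  simp only [Fml.inst, Fml.sub_bdEqual, Tm.up_sub_snoc, Tm.sub_vr, snoc_last', Tm.sub_id,
    Tm.sub_sub, Tm.snoc_sub] at this
  exact this (.eqI _)

end Deriv

/-! ### Passing from arithmetic to an extension of its language -/

section Translation

variable {L : FirstOrder.Language.{u, v}} {n m : ℕ} (ι : arith →ᴸ L)

theorem onTerm_sub (t : Tm arith n) (s : Fin n → Tm arith m) :
    ι.onTerm (t.sub s) = Tm.sub (ι.onTerm t) fun i => ι.onTerm (s i) := by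
  induction t with
  | var x => rcases x with x | x
             · exact x.elim
             · rfl
  | func f ts ih =>
    rw [Tm.sub_func]
    exact congrArg (Term.func _) (funext ih)

theorem onFml_sub (φ : Fml arith n) (s : Fin n → Tm arith m) :
    ι.onBoundedFormula (φ.sub s) = Fml.sub (ι.onBoundedFormula φ) fun i => ι.onTerm (s i) := by
  induction φ generalizing m with
  | falsum => rfl
  | equal t₁ t₂ => simp only [Fml.sub, LHom.onBoundedFormula, onTerm_sub, Term.bdEqual]
  | rel R ts => exact R.elim
  | imp φ ψ ih₁ ih₂ => simp only [Fml.sub, LHom.onBoundedFormula, ih₁, ih₂]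
  | all φ ih =>
    simp only [Fml.sub, LHom.onBoundedFormula, ih, comp_snoc ι.onTerm, Tm.up, onTerm_sub]
    rfl

theorem onFml_inst (φ : Fml arith (n + 1)) (t : Tm arith n) :
    ι.onBoundedFormula (φ.inst t) = Fml.inst (ι.onBoundedFormula φ) (ι.onTerm t) := by
  rw [Fml.inst, onFml_sub, comp_snoc ι.onTerm]
  rfl

/-- A theory that proves the translations of the axioms of `T₀` proves those of its theorems. -/
theorem Deriv.translate {T₀ : arith.Theory} {T : L.Theory}
    (hT : ∀ φ ∈ T₀, Proves T (ι.onSentence φ)) {Γ : List (Fml arith n)} {φ : Fml arith n}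
    (h : Deriv T₀ Γ φ) : Deriv T (Γ.map ι.onBoundedFormula) (ι.onBoundedFormula φ) := by
  induction h with
  | ax φ hφ =>
    rw [onFml_sub]
    -- The given proof has no free variables and no hypotheses; it is moved to the current variables
    -- and context.
    exact ((hT φ hφ).sub _).weaken (List.nil_subset _)
  | hyp hφ => exact .hyp (List.mem_map_of_mem hφ)
  | impI _ ih => exact .impI ih
  | impE _ _ ih₁ ih₂ => exact .impE ih₁ ih₂
  | raa _ ih => exact .raa ih
  | allI _ ih =>
    refine .allI ?_
    rw [List.map_map] at ih ⊢
    rwa [List.map_congr_left (g := Fml.up ∘ ι.onBoundedFormula)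
      fun γ _ => onFml_sub ι γ _] at ih
  | allE t _ ih => rw [onFml_inst]; exact .allE _ ih
  | eqI t => exact .eqI _
  | eqE φ _ _ ih₁ ih₂ =>
    rw [onFml_inst] at ih₂ ⊢
    exact .eqE _ ih₁ ih₂

end Translation

/-! ### Substitution in arithmetical terms and formulas -/

section ArithSubstitution

variable {n m : ℕ}

@[simp] theorem sub_zr (s : Fin n → Tm arith m) : Tm.sub zr s = zr := by
  exact congrArg (Term.func (L := arith) ArithFunc.zero) (funext fun i => i.elim0)

@[simp] theorem sub_sc (t : Tm arith n) (s : Fin n → Tm arith m) :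
    Tm.sub (sc t) s = sc (t.sub s) := by
  exact congrArg (Term.func (L := arith) ArithFunc.succ) (funext fun i => by fin_cases i; rfl)

@[simp] theorem sub_ad (t u : Tm arith n) (s : Fin n → Tm arith m) :
    Tm.sub (ad t u) s = ad (t.sub s) (u.sub s) := by
  exact congrArg (Term.func (L := arith) ArithFunc.add) (funext fun i => by fin_cases i <;> rfl)

@[simp] theorem sub_ml (t u : Tm arith n) (s : Fin n → Tm arith m) :
    Tm.sub (ml t u) s = ml (t.sub s) (u.sub s) := by
  exact congrArg (Term.func (L := arith) ArithFunc.mul) (funext fun i => by fin_cases i <;> rfl)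

@[simp] theorem sub_numeral (k : ℕ) (s : Fin n → Tm arith m) :
    Tm.sub (numeral k) s = numeral k := by
  induction k with
  | zero => exact sub_zr s
  | succ k ih => rw [numeral, sub_sc, ih, numeral]

@[simp] theorem up_ad (t u : Tm arith n) : (ad t u).up = ad t.up u.up := sub_ad _ _ _

@[simp] theorem up_numeral (k : ℕ) : (numeral k : Tm arith n).up = numeral k := sub_numeral _ _

theorem sub_leF (t u : Tm arith n) (s : Fin n → Tm arith m) :
    Fml.sub (leF t u) s = leF (t.sub s) (u.sub s) := by
  simp only [leF, Fml.sub_ex, Fml.sub_bdEqual, sub_ad, Tm.up_sub_snoc, Tm.sub_vr, snoc_last',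
    Tm.sub_up]

theorem sub_ltF (t u : Tm arith n) (s : Fin n → Tm arith m) :
    Fml.sub (ltF t u) s = ltF (t.sub s) (u.sub s) := by
  rw [ltF, sub_leF, sub_sc, ltF]

theorem up_bdEqual (t u : Tm arith n) : Fml.up (t =' u) = (t.up =' u.up) := rfl

end ArithSubstitution

namespace Deriv

/-! ### Equality and order under replacement of equals -/

section Congruence

variable {T : arith.Theory} {n : ℕ} {Γ : List (Fml arith n)} {a a' b b' : Tm arith n}

theorem sc_congr (h : Deriv T Γ (a =' b)) : Deriv T Γ (sc a =' sc b) := by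
  simpa using congr_snoc (sc (vr (Fin.last n))) (fun i => vr i) h

theorem ad_congr (ha : Deriv T Γ (a =' a')) (hb : Deriv T Γ (b =' b')) :
    Deriv T Γ (ad a b =' ad a' b') := by
  have h₁ := congr_snoc (ad (vr (Fin.last n)) b.up) (fun i => vr i) ha
  have h₂ := congr_snoc (ad a'.up (vr (Fin.last n))) (fun i => vr i) hb
  simp only [sub_ad, Tm.up_sub_snoc, Tm.sub_vr, snoc_last', Tm.sub_id] at h₁ h₂
  exact h₁.trans h₂

theorem ml_congr (ha : Deriv T Γ (a =' a')) (hb : Deriv T Γ (b =' b')) :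
    Deriv T Γ (ml a b =' ml a' b') := by
  have h₁ := congr_snoc (ml (vr (Fin.last n)) b.up) (fun i => vr i) ha
  have h₂ := congr_snoc (ml a'.up (vr (Fin.last n))) (fun i => vr i) hb
  simp only [sub_ml, Tm.up_sub_snoc, Tm.sub_vr, snoc_last', Tm.sub_id] at h₁ h₂
  exact h₁.trans h₂

theorem leI (c : Tm arith n) (h : Deriv T Γ (ad c a =' b)) : Deriv T Γ (leF a b) := by
  refine exI c ?_
  simpa only [Fml.inst, Fml.sub_bdEqual, sub_ad, Tm.up_sub_snoc, Tm.sub_vr, snoc_last',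
    Tm.sub_id] using h

theorem leE {ψ : Fml arith n} (h : Deriv T Γ (leF a b))
    (h' : Deriv T ((ad (vr (Fin.last n)) a.up =' b.up) :: Γ.map Fml.up) ψ.up) :
    Deriv T Γ ψ :=
  exE h h'

theorem le_congr (ha : Deriv T Γ (a =' a')) (hb : Deriv T Γ (b =' b'))
    (h : Deriv T Γ (leF a b)) : Deriv T Γ (leF a' b') := by
  refine leE h ?_
  rw [Fml.up, sub_leF]
  exact leI (vr (Fin.last n))
    ((ad_congr (eqI _) ha.symm.up.wk).trans (hd.trans hb.up.wk))

theorem lt_congr (ha : Deriv T Γ (a =' a')) (hb : Deriv T Γ (b =' b'))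
    (h : Deriv T Γ (ltF a b)) : Deriv T Γ (ltF a' b') :=
  le_congr (sc_congr ha) hb h

end Congruence

/-! ### Numerals and order in Robinson's arithmetic -/

section Robinson

variable {n : ℕ} {Γ : List (Fml arith n)} {φ : Fml arith n} (t u : Tm arith n)

theorem ax_all {ψ : Fml arith 1} (h : QAxiom (∀' ψ)) : Deriv Q Γ (ψ.sub ![t]) := by
  have := allE t (ax (T := Q) (Γ := Γ) _ h)
  simp only [Fml.inst, Fml.sub_sub, Tm.snoc_sub, Tm.sub_vr, snoc_last'] at this
  convert this using 2
  funext i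
  fin_cases i
  rfl

theorem ax_all_all {ψ : Fml arith 2} (h : QAxiom (∀' ∀' ψ)) : Deriv Q Γ (ψ.sub ![t, u]) := by
  have := allE u (allE t (ax (T := Q) (Γ := Γ) _ h))
  simp only [Fml.inst, Fml.sub_sub, Tm.snoc_sub, Tm.up_sub_snoc, Tm.sub_vr,
    snoc_last', Tm.sub_id] at this
  convert this using 2
  funext i
  fin_cases i <;> rfl

theorem sc_ne_zr {t : Tm arith n} (h : Deriv Q Γ (sc t =' zr)) : Deriv Q Γ φ := by
  have := ax_all (Γ := Γ) t QAxiom.succ_ne_zero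
  simp only [Fml.sub_bdEqual, Fml.sub_not, sub_sc, sub_zr] at this
  exact exfalso (.impE this h)

theorem sc_inj {t u : Tm arith n} (h : Deriv Q Γ (sc t =' sc u)) : Deriv Q Γ (t =' u) := by
  have := ax_all_all (Γ := Γ) t u QAxiom.succ_inj
  simp only [Fml.sub_bdEqual, Fml.sub_imp, sub_sc] at this
  exact .impE this h

theorem zr_or_sc {t : Tm arith n} (h₁ : Deriv Q ((t =' zr) :: Γ) φ)
    (h₂ : Deriv Q ((t.up =' sc (vr (Fin.last n))) :: Γ.map Fml.up) φ.up) : Deriv Q Γ φ := by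
  have := ax_all (Γ := Γ) t QAxiom.zero_or_succ
  simp only [Fml.sub_bdEqual, Fml.sub_sup, Fml.sub_ex, sub_sc, sub_zr] at this
  exact orE this h₁ (exE hd (h₂.weaken (List.cons_subset_cons _ (List.subset_cons_self _ _))))

theorem ad_zr : Deriv Q Γ (ad t zr =' t) := by
  have := ax_all (Γ := Γ) t QAxiom.add_zero
  simp only [Fml.sub_bdEqual, sub_zr, sub_ad] at this
  exact this

theorem ad_sc : Deriv Q Γ (ad t (sc u) =' sc (ad t u)) := by
  have := ax_all_all (Γ := Γ) t u QAxiom.add_succ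
  simp only [Fml.sub_bdEqual, sub_sc, sub_ad] at this
  exact this

theorem ml_zr : Deriv Q Γ (ml t zr =' zr) := by
  have := ax_all (Γ := Γ) t QAxiom.mul_zero
  simp only [Fml.sub_bdEqual, sub_zr, sub_ml] at this
  exact this

theorem ml_sc : Deriv Q Γ (ml t (sc u) =' ad (ml t u) t) := by
  have := ax_all_all (Γ := Γ) t u QAxiom.mul_succ
  simp only [Fml.sub_bdEqual, sub_sc, sub_ad, sub_ml] at this
  exact this

theorem ad_numeral (k l : ℕ) :
    Deriv Q Γ (ad (numeral k) (numeral l) =' numeral (k + l)) := by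
  induction l with
  | zero => exact ad_zr _
  | succ l ih => exact (ad_sc _ _).trans (sc_congr ih)

theorem ml_numeral (k l : ℕ) :
    Deriv Q Γ (ml (numeral k) (numeral l) =' numeral (k * l)) := by
  induction l with
  | zero => exact ml_zr _
  | succ l ih =>
    exact (ml_sc _ _).trans ((ad_congr ih (eqI _)).trans (ad_numeral _ _))

theorem numeral_ne {k l : ℕ} (hkl : k ≠ l) (h : Deriv Q Γ (numeral k =' numeral l)) :
    Deriv Q Γ φ := by
  induction k generalizing l with
  | zero =>
    cases l with
    | zero => exact absurd rfl hkl
    | succ l => exact sc_ne_zr h.symm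
  | succ k ih =>
    cases l with
    | zero => exact sc_ne_zr h
    | succ l => exact ih (fun e => hkl (congrArg _ e)) (sc_inj h)

/-- Induction on `k` outside the theory: if `t = S(t')`, then `u + t = S(u + t')`, which is
impossible for `k = 0` and otherwise reduces to `u + t'` equal to the predecessor of `k`. The
argument works because `t` is the right summand, on which addition recurses. Each round introduces a
new variable `t'`, so the number of variables must be general. -/
theorem cases_of_ad_eq_numeral {k : ℕ} {n : ℕ} {Γ : List (Fml arith n)} {φ : Fml arith n}
    {t u : Tm arith n} (h : Deriv Q Γ (ad u t =' numeral k))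
    (h' : ∀ j ≤ k, Deriv Q ((t =' numeral j) :: Γ) φ) : Deriv Q Γ φ := by
  induction k generalizing n with
  | zero =>
    refine zr_or_sc (t := t) (h' 0 le_rfl) ?_
    refine sc_ne_zr (t := ad u.up (vr (Fin.last n))) ?_
    have h := h.up.wk (ψ := t.up =' sc (vr (Fin.last n)))
    rw [up_bdEqual, up_ad, up_numeral] at h
    exact (ad_sc _ _).symm.trans ((ad_congr (eqI _) hd.symm).trans h)
  | succ k ih =>
    refine zr_or_sc (t := t) (h' 0 (Nat.zero_le _)) ?_
    refine ih (t := vr (Fin.last n)) (u := u.up) (sc_inj ?_) fun j hj => ?_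
    · have h := h.up.wk (ψ := t.up =' sc (vr (Fin.last n)))
      rw [up_bdEqual, up_ad, up_numeral] at h
      exact (ad_sc _ _).symm.trans ((ad_congr (eqI _) hd.symm).trans h)
    · have h := (h' (j + 1) (Nat.succ_le_succ hj)).impI.up
      refine .impE h.wk.wk ?_
      rw [Fml.sub_bdEqual, sub_numeral]
      exact hd.wk.trans (sc_congr hd)

theorem cases_of_le_numeral {k : ℕ} {t : Tm arith n} (h : Deriv Q Γ (leF t (numeral k)))
    (h' : ∀ j ≤ k, Deriv Q ((t =' numeral j) :: Γ) φ) : Deriv Q Γ φ := by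
  refine leE h (cases_of_ad_eq_numeral (k := k) (t := t.up) (u := vr (Fin.last n)) ?_
    fun j hj => ?_)
  · simpa using hd
  · refine .impE (h' j hj).impI.up.wk.wk ?_
    rw [Fml.sub_bdEqual, sub_numeral]
    exact hd

theorem cases_of_lt_numeral {k : ℕ} {t : Tm arith n} (h : Deriv Q Γ (ltF t (numeral k)))
    (h' : ∀ j < k, Deriv Q ((t =' numeral j) :: Γ) φ) : Deriv Q Γ φ := by
  refine cases_of_le_numeral h fun j hj => ?_
  cases j with
  -- `t < k` means `S(t) ≤ k`, so the cases are `S(t) = j` with `j ≤ k`: zero is excluded, and the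
  -- others lose one successor.
  | zero => exact sc_ne_zr hd
  | succ j => exact .impE (h' j hj).impI.wk (sc_inj hd)

theorem le_numeral {k l : ℕ} (h : k ≤ l) : Deriv Q Γ (leF (numeral k) (numeral l)) := by
  have := ad_numeral (Γ := Γ) (l - k) k
  rw [Nat.sub_add_cancel h] at this
  exact leI _ this

theorem le_numeral_elim {k l : ℕ} (hkl : ¬ k ≤ l)
    (h : Deriv Q Γ (leF (numeral k) (numeral l))) : Deriv Q Γ φ :=
  cases_of_le_numeral h fun _ hj => numeral_ne (fun e => hkl (e.trans_le hj)) hd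

theorem sc_le_sc {t u : Tm arith n} (h : Deriv Q Γ (leF t u)) :
    Deriv Q Γ (leF (sc t) (sc u)) := by
  refine leE h ?_
  rw [Fml.up, sub_leF, sub_sc, sub_sc]
  exact leI (vr (Fin.last n)) ((ad_sc _ _).trans (sc_congr hd))

/-- Induction on `k` outside the theory, splitting `t` into zero or a successor `S(t')`: the
comparison of `t'` with `k` is transported to that of `S(t')` with `k + 1` by `sc_le_sc`. -/
theorem lt_trichotomy (k : ℕ) {n : ℕ} {Γ : List (Fml arith n)} {φ : Fml arith n}
    {t : Tm arith n} (h₁ : Deriv Q (ltF t (numeral k) :: Γ) φ)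
    (h₂ : Deriv Q ((t =' numeral k) :: Γ) φ)
    (h₃ : Deriv Q (ltF (numeral k) t :: Γ) φ) : Deriv Q Γ φ := by
  induction k generalizing n with
  | zero =>
    refine zr_or_sc h₂ (.impE h₃.impI.up.wk ?_)
    rw [sub_ltF, sub_numeral]
    -- The predecessor `x` of `t` is the witness: `x + S(0) = S(x + 0) = S(x) = t`.
    refine leI (vr (Fin.last n)) ?_
    exact (ad_sc _ _).trans ((sc_congr (ad_zr _)).trans hd.symm)
  | succ k ih =>
    refine zr_or_sc (t := t) (.impE h₁.impI.wk ?_)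
      (ih (t := vr (Fin.last n)) (.impE h₁.impI.up.wk.wk ?_) (.impE h₂.impI.up.wk.wk ?_)
        (.impE h₃.impI.up.wk.wk ?_))
    · exact lt_congr hd.symm (eqI _) (le_numeral (k := 1) (Nat.succ_le_succ (Nat.zero_le _)))
    · rw [sub_ltF, sub_numeral]
      exact lt_congr hd.wk.symm (eqI _) (sc_le_sc hd)
    · rw [Fml.sub_bdEqual, sub_numeral]
      exact hd.wk.trans (sc_congr hd)
    · rw [sub_ltF, sub_numeral]
      exact lt_congr (eqI _) hd.wk.symm (sc_le_sc hd)

end Robinson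

end Deriv

/-! ### Iterated conjunctions and existential quantifiers -/

section ConjunctionsAndExistentials

variable {L : FirstOrder.Language.{u, v}} {T : L.Theory} {n m : ℕ} {Γ : List (Fml L n)}

theorem sub_foldr_inf (φ : Fml L n) (l : List (Fml L n)) (s : Fin n → Tm L m) :
    Fml.sub (l.foldr (fun φ ψ => φ ⊓ ψ) φ) s =
      (l.map fun ψ => ψ.sub s).foldr (fun φ ψ => φ ⊓ ψ) (φ.sub s) := by
  induction l with
  | nil => rfl
  | cons ψ l ih => simp only [List.foldr_cons, List.map_cons, Fml.sub_inf, ih]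

theorem Deriv.foldr_inf_iff {φ : Fml L n} {l : List (Fml L n)} :
    Deriv T Γ (l.foldr (fun φ ψ => φ ⊓ ψ) φ) ↔ (∀ ψ ∈ l, Deriv T Γ ψ) ∧ Deriv T Γ φ := by
  induction l with
  | nil => simp
  | cons ψ l ih =>
    rw [List.foldr_cons, List.forall_mem_cons, and_assoc, ← ih]
    exact ⟨fun h => ⟨h.andE₁, h.andE₂⟩, fun h => andI h.1 h.2⟩

theorem Deriv.exN_intro {φ : Fml L (n + m)} (w : Fin m → Tm L n)
    (h : Deriv T Γ (φ.sub (Fin.append (fun i => vr i) w))) : Deriv T Γ (exN m φ) := by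
  induction m with
  | zero =>
    have e : Fin.append (fun i => vr i) w = fun i => vr i := by
      rw [Fin.append_right_nil _ _ rfl]
      rfl
    rw [e, Fml.sub_id] at h
    exact h
  | succ m ih =>
    refine ih (fun i => w i.castSucc) ?_
    rw [Fml.sub_ex]
    refine exI (w (Fin.last m)) ?_
    -- The last variable is quantified innermost in `exN`, so its witness is split off from the end
    -- of the tuple.
    have e : Fin.append (fun i => vr i) w =
        snoc (Fin.append (fun i => vr i) fun i => w i.castSucc) (w (Fin.last m)) := by
      funext i
      refine Fin.lastCases ?_ (fun i => ?_) i
      · exact (Fin.append_right _ w (Fin.last m)).trans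
          (snoc_last' (Fin.append (fun i => vr i) fun i => w i.castSucc) _).symm
      · rw [snoc_castSucc']
        refine Fin.addCases (fun i => ?_) (fun i => ?_) i
        · rw [Fin.append_left]
          exact Fin.append_left _ _ _
        · rw [Fin.append_right]
          exact Fin.append_right _ w i.castSucc
    rw [e, Fml.sub_snoc_eq_inst (n := n + m)] at h
    exact h

theorem Deriv.exN_elim {φ : Fml L (n + m)} {ψ : Fml L n} (h : Deriv T Γ (exN m φ))
    (h' : Deriv T (φ :: Γ.map fun γ => γ.sub fun i => vr (Fin.castAdd m i))
      (ψ.sub fun i => vr (Fin.castAdd m i))) : Deriv T Γ ψ := by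
  induction m with
  | zero =>
    have e (γ : Fml L n) : (γ.sub fun i => vr (Fin.castAdd 0 i)) = γ := γ.sub_id
    simp only [e, List.map_id'] at h'
    exact .impE h'.impI h
  | succ m ih =>
    refine ih h (exE hd (.weaken (Δ := _ :: _) (Γ := φ :: _) ?_
      (List.cons_subset_cons _ (List.subset_cons_self _ _))))
    rw [List.map_map]
    have e (γ : Fml L n) : (γ.sub fun i => vr (Fin.castAdd m i)).up =
        γ.sub fun i => vr (Fin.castAdd (m + 1) i) := Fml.sub_sub _ _ _
    simpa only [Function.comp_def, e] using h'

end ConjunctionsAndExistentials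

/-! ### Representation of programs -/

/-- Whenever the terms `s` are provably equal to the numerals of `p`, the formula `φ[s, t]` is
provably equivalent to `t = r`. -/
def Represents {n : ℕ} (φ : Fml arith (n + 1)) (p : Fin n → ℕ) (r : ℕ) : Prop :=
  ∀ ⦃m : ℕ⦄ ⦃Γ : List (Fml arith m)⦄ ⦃s : Fin n → Tm arith m⦄ ⦃t : Tm arith m⦄,
    (∀ i, Deriv Q Γ (s i =' numeral (p i))) →
      (Deriv Q Γ (φ.sub (snoc s t)) ↔ Deriv Q Γ (t =' numeral r))

open Deriv

theorem snoc_eq_numeral {n m : ℕ} {Γ : List (Fml arith m)} {s : Fin n → Tm arith m}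
    {t : Tm arith m} {p : Fin n → ℕ} {k : ℕ} (hs : ∀ i, Deriv Q Γ (s i =' numeral (p i)))
    (ht : Deriv Q Γ (t =' numeral k)) (i : Fin (n + 1)) :
    Deriv Q Γ (snoc s t i =' numeral (snoc p k i)) := by
  refine Fin.lastCases ?_ (fun i => ?_) i
  · simpa using ht
  · simpa using hs i

theorem up_eq_numeral {n k : ℕ} {Γ : List (Fml arith n)} {t : Tm arith n}
    (h : Deriv Q Γ (t =' numeral k)) : Deriv Q (Γ.map Fml.up) (t.up =' numeral k) := by
  have := h.up
  rwa [up_bdEqual, up_numeral] at this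

/-- It is enough to treat variables: the hypotheses `xᵢ = pᵢ` form a context `Γ₀`, a derivation from
it can be substituted along `s` and `t`, and the resulting hypotheses are cut against the proofs of
`s i = pᵢ`. -/
theorem represents_of_generic {n : ℕ} {φ : Fml arith (n + 1)} {p : Fin n → ℕ} {r : ℕ}
    (h : ∀ Γ : List (Fml arith (n + 1)),
      (∀ i : Fin n, Deriv Q Γ (vr i.castSucc =' numeral (p i))) →
        (Deriv Q Γ φ ↔ Deriv Q Γ (vr (Fin.last n) =' numeral r))) : Represents φ p r := by
  intro m Γ s t hs
  let Γ₀ : List (Fml arith (n + 1)) := List.ofFn fun i : Fin n => vr i.castSucc =' numeral (p i)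
  have hΓ₀ (i : Fin n) : Deriv Q Γ₀ (vr i.castSucc =' numeral (p i)) :=
    hyp (List.mem_ofFn.2 ⟨i, rfl⟩)
  have key (ψ χ : Fml arith (n + 1)) (hψ : Deriv Q (ψ :: Γ₀) χ)
      (h : Deriv Q Γ (ψ.sub (snoc s t))) : Deriv Q Γ (χ.sub (snoc s t)) := by
    refine (hψ.sub (snoc s t)).cut fun γ hγ => ?_
    rw [List.map_cons, List.mem_cons, List.mem_map] at hγ
    rcases hγ with rfl | ⟨δ, hδ, rfl⟩
    · exact h
    · obtain ⟨i, rfl⟩ := List.mem_ofFn.1 hδ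
      simpa only [Fml.sub_bdEqual, Tm.sub_vr, snoc_castSucc', sub_numeral] using hs i
  have e : Fml.sub (vr (Fin.last n) =' numeral r) (snoc s t) = (t =' numeral r) := by
    simp only [Fml.sub_bdEqual, Tm.sub_vr, snoc_last', sub_numeral]
  rw [← e]
  -- Adding one side to `Γ₀` and applying `h` there turns an equivalence of derivabilities into an
  -- entailment.
  exact ⟨key _ _ ((h _ fun i => (hΓ₀ i).wk).1 hd), key _ _ ((h _ fun i => (hΓ₀ i).wk).2 hd)⟩

theorem represents_of_eq {n : ℕ} {p : Fin n → ℕ} {r : ℕ} (u : Tm arith (n + 1))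
    (h : ∀ Γ : List (Fml arith (n + 1)),
      (∀ i : Fin n, Deriv Q Γ (vr i.castSucc =' numeral (p i))) → Deriv Q Γ (u =' numeral r)) :
    Represents (vr (Fin.last n) =' u) p r :=
  represents_of_generic fun Γ hΓ => ⟨fun h' => h'.trans (h Γ hΓ), fun h' => h'.trans (h Γ hΓ).symm⟩

theorem represents_chiLe (p : Fin 2 → ℕ) :
    Represents Prog.chiLe.rep p (if p 0 ≤ p 1 then 1 else 0) := by
  refine represents_of_generic fun Γ hΓ => ?_
  have h₀ : Deriv Q Γ (vr 0 =' numeral (p 0)) := hΓ 0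
  have h₁ : Deriv Q Γ (vr 1 =' numeral (p 1)) := hΓ 1
  by_cases hp : p 0 ≤ p 1
  · rw [if_pos hp]
    refine ⟨fun h => orE h hd.andE₂ ?_, fun h => orI₁ (andI ?_ h)⟩
    · exact le_numeral_elim (Nat.not_le.2 (Nat.lt_succ_of_le hp))
        (lt_congr h₁.wk h₀.wk hd.andE₁)
    · exact le_congr h₀.symm h₁.symm (le_numeral hp)
  · rw [if_neg hp]
    refine ⟨fun h => orE h ?_ hd.andE₂, fun h => orI₂ (andI ?_ h)⟩
    · exact le_numeral_elim hp (le_congr h₀.wk h₁.wk hd.andE₁)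
    · exact lt_congr h₁.symm h₀.symm (le_numeral (k := p 1 + 1) (Nat.not_le.1 hp))

theorem represents_comp {n m : ℕ} {h : Prog m} {g : Fin m → Prog n} {p : Fin n → ℕ}
    {a : Fin m → ℕ} {r : ℕ} (hg : ∀ i, Represents (g i).rep p (a i))
    (hh : Represents h.rep a r) : Represents (Prog.comp h g).rep p r := by
  refine represents_of_generic fun Γ hΓ => ⟨fun H => ?_, fun H => ?_⟩
  · refine exN_elim H ?_
    rw [Fml.sub_bdEqual, sub_numeral, Tm.sub_vr]
    obtain ⟨H₁, H₂⟩ := foldr_inf_iff.1 (hd (T := Q) (Γ := Γ.map fun γ => γ.sub fun i =>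
      vr (Fin.castAdd m i)))
    -- The arguments of `h` are the eigenvariables `wᵢ`, which the formulas of the `g i` prove equal
    -- to the numerals of `a i`.
    refine (hh fun i => ?_).1 H₂
    refine (hg i fun j => ?_).1 (H₁ _ (List.mem_ofFn.2 ⟨i, rfl⟩))
    have := (hΓ j).sub fun i => vr (Fin.castAdd m i)
    rw [Fml.sub_bdEqual, sub_numeral, Tm.sub_vr] at this
    exact this.wk
  · refine exN_intro (fun i => numeral (a i)) ?_
    rw [sub_foldr_inf, foldr_inf_iff]
    simp only [List.mem_map, List.mem_ofFn, forall_exists_index, and_imp,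
      forall_apply_eq_imp_iff, Fml.sub_sub, Tm.snoc_sub, Tm.sub_vr, Fin.append_left,
      Fin.append_right]
    exact ⟨fun i => (hg i hΓ).2 (eqI _), (hh fun i => eqI _).2 H⟩

/-- The values of `g` below `r` are given as successors `v z + 1`, so that `v z` is the witness for
`w` in `B[x, z, S(w)]`. -/
theorem represents_mu {n : ℕ} {g : Prog (n + 1)} {p : Fin n → ℕ} {r : ℕ} (v : ℕ → ℕ)
    (hr : Represents g.rep (snoc p r) 0)
    (hv : ∀ z < r, Represents g.rep (snoc p z) (v z + 1)) :
    Represents (Prog.mu g).rep p r := by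
  refine represents_of_generic fun Γ hΓ => ⟨fun H => ?_, fun H => andI ?_ ?_⟩
  · refine lt_trichotomy r (cases_of_lt_numeral hd fun j hj => ?_) hd ?_
    -- Case `y = j < r`: the second conjunct `B[x, y, 0]` forces `0 = S(v j)`.
    · exact sc_ne_zr ((hv j hj (snoc_eq_numeral (fun i => (hΓ i).wk.wk) hd)).1
        H.andE₂.wk.wk).symm
    -- Case `r < y`: the first conjunct at `z = r` yields `B[x, r, S(w)]`, while `g` has value `0`
    -- there, so `S(w) = 0`.
    · have := (allE (numeral r) H.andE₁).wk (ψ := ltF (numeral r) (vr (Fin.last n)))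
      simp only [Fml.inst, Fml.sub_imp, Fml.sub_ex, sub_ltF, Tm.sub_vr, snoc_last',
        snoc_castSucc', Fml.sub_sub, Tm.snoc_sub, sub_sc, Tm.up_vr, up_numeral] at this
      refine exE (this.impE hd) ?_
      refine sc_ne_zr ((hr (snoc_eq_numeral (fun i => ?_) (eqI _))).1 hd)
      exact (up_eq_numeral (hΓ i)).wk.wk
  · refine allI (impI ?_)
    refine cases_of_lt_numeral (lt_congr (eqI _) (up_eq_numeral H).wk hd) fun j hj => exI (numeral (v j)) ?_
    simp only [Fml.inst, Tm.sub_vr, snoc_last',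
        snoc_castSucc', Fml.sub_sub, Tm.snoc_sub, sub_sc]
    exact (hv j hj (snoc_eq_numeral (fun i => (up_eq_numeral (hΓ i)).wk.wk) hd)).2 (eqI _)
  · exact (hr (snoc_eq_numeral hΓ H)).2 (eqI _)

/-- A program is represented, in Robinson's arithmetic, by its formula. -/
theorem represents_rep {n : ℕ} (f : Prog n) (p : Fin n → ℕ) (r : ℕ) (hr : r ∈ f.eval p) :
    Represents f.rep p r := by
  induction f generalizing r with
  | proj i =>
    obtain rfl := Part.mem_some_iff.1 hr
    exact represents_of_eq _ fun Γ hΓ => hΓ i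
  | zero n =>
    obtain rfl := Part.mem_some_iff.1 hr
    exact represents_of_eq _ fun Γ _ => eqI _
  | succ =>
    obtain rfl := Part.mem_some_iff.1 hr
    exact represents_of_eq _ fun Γ hΓ => sc_congr (hΓ 0)
  | add =>
    obtain rfl := Part.mem_some_iff.1 hr
    exact represents_of_eq _ fun Γ hΓ => (ad_congr (hΓ 0) (hΓ 1)).trans (ad_numeral _ _)
  | mul =>
    obtain rfl := Part.mem_some_iff.1 hr
    exact represents_of_eq _ fun Γ hΓ => (ml_congr (hΓ 0) (hΓ 1)).trans (ml_numeral _ _)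
  | chiLe =>
    obtain rfl := Part.mem_some_iff.1 hr
    exact represents_chiLe p
  | comp h g ihh ihg =>
    obtain ⟨a, ⟨hd, rfl⟩, ha⟩ := Part.mem_bind_iff.1 hr
    exact represents_comp (fun i => ihg i p _ (Part.get_mem (hd i))) (ihh _ _ ha)
  | mu g ih =>
    obtain ⟨h₀, h₁⟩ := Nat.mem_rfind.1 hr
    -- Stated for every `z`, with the dummy value `0` from `r` on, so that the choice gives a
    -- function on all of `ℕ`.
    have hv (z : ℕ) : ∃ v, z < r → v + 1 ∈ g.eval (snoc p z) := by
      by_cases hz : z < r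
      · obtain ⟨w, hw, hw'⟩ := (Part.mem_map_iff _).1 (h₁ hz)
        obtain ⟨v, rfl⟩ := Nat.exists_eq_succ_of_ne_zero (of_decide_eq_false hw')
        exact ⟨v, fun _ => hw⟩
      · exact ⟨0, fun h => absurd h hz⟩
    choose v hv using hv
    obtain ⟨w, hw, hw'⟩ := (Part.mem_map_iff _).1 h₀
    obtain rfl := of_decide_eq_true hw'
    exact represents_mu v (ih _ _ hw) fun z hz => ih _ _ (hv z hz)

theorem proves_repSentence {n : ℕ} (f : Prog n) (p : Fin n → ℕ) (r : ℕ) (hr : r ∈ f.eval p) :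
    Proves Q (f.repSentence p r) :=
  allI (iffI ((represents_rep f p r hr fun _ => eqI _).1 hd)
    ((represents_rep f p r hr fun _ => eqI _).2 hd))

end Arith

theorem mainTheorem4 {L : FirstOrder.Language.{u, v}} (ι : Arith.arith →ᴸ L) (T : L.Theory)
    (hT : ∀ φ ∈ Arith.Q, Arith.Proves T (ι.onSentence φ))
    {n : ℕ} (f : Arith.Prog n) (p : Fin n → ℕ) (hp : (f.eval p).Dom) :
    Arith.Proves T (ι.onSentence (f.repSentence p ((f.eval p).get hp))) :=
  (Arith.proves_repSentence f p _ (Part.get_mem hp)).translate ι hT
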